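/- **Theorem 1 (Quantum amplitude estimation with arbitrary success probability).** Let $|\psi\rangle$ be a unit vector of a complex Hilbert space, $P$ an orthogonal projection, $U=2|\psi\rangle\langle\psi|-I$, $V=I-2P$ and $a=\langle\psi|P|\psi\rangle$. One *run* of (Brassard–Høyer–Mosca–Tapp) amplitude estimation of order $M$ prepares a control register $\mathbb C^M$ in $|0\rangle$, applies the quantum Fourier transform on $\mathbb Z/M$ to it, applies $|j\rangle|\varphi\rangle\mapsto|j\rangle(UV)^j|\varphi\rangle$ by means of $M-1$ controlled uses of $UV$, applies the inverse Fourier transform to the control register and measures it; the outcome $y\in\{0,\dots,M-1\}$ gives the estimate $\sin^2(\pi y/M)$. Consider the algorithm that performs $2r+1$ successive runs on a single copy of $|\psi\rangle$ (each run continues with the data state that the preceding measurement left) and outputs the median $\tilde a$ of the $2r+1$ estimates. There is an absolute constant $C>0$ such that for all $0<\epsilon\le 1$, $0<\delta<1$ and $0<\alpha\le 1$ there are an even $M\ge 2$ and an $r\ge 0$, depending on $\epsilon,\delta,\alpha$ only, for which this algorithm uses $UV$ at most $$C\,\frac{1}{\epsilon\sqrt{\alpha}}\,\ln\frac{2}{\delta}$$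 times, and for every complex Hilbert space and all $|\psi\rangle$ and $P$ as above: 1. if $a\ge\alpha$, then $|\tilde a-a|\le\epsilon a$ with probability at least $1-\delta$; 2. if $a=0$ or $a=1$, then $\tilde a=a$ with probability $1$. In particular, if the algorithm is run with $\alpha=a>0$, then $|\tilde a-a|/a\le\epsilon$ holds with probability at least $1-\delta$, with $O\!\left(\frac{1}{\epsilon\sqrt a}\ln\frac2\delta\right)$ uses of $UV$. -/

import Mathlib

universe u

namespace AmpEst

noncomputable section

/-! ### The two reflections -/

section Operators

variable {H : Type*} [NormedAddCommGroup H] [InnerProductSpace ℂ H]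

/-- The reflection `U = 2|ψ⟩⟨ψ| - I`. -/
def reflState (ψ : H) : H →L[ℂ] H :=
  (2 : ℂ) • InnerProductSpace.rankOne ℂ ψ ψ - 1

/-- The reflection `V = I - 2P`. -/
def reflProj (P : H →L[ℂ] H) : H →L[ℂ] H :=
  1 - (2 : ℂ) • P

/-- The operator `UV`, whose uses are counted. -/
def grover (ψ : H) (P : H →L[ℂ] H) : H →L[ℂ] H :=
  reflState ψ * reflProj P

/-- The quantity to be estimated, `a = ⟨ψ|P|ψ⟩` (a real number when `P` is an orthogonal
projection). -/
def amplitude (ψ : H) (P : H →L[ℂ] H) : ℝ :=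
  (inner ℂ ψ (P ψ)).re

end Operators

/-! ### Circuits with queries

The joint space `ℂ^M ⊗ H` of a control register with basis states `|0⟩, …, |M-1⟩` and a data
register `H` is represented as `Fin M → H`: the family `Φ` is the vector `∑ j, |j⟩ ⊗ Φ j`. -/

/-- A gate is either a unitary on the control register, which does not involve the unknown
operator `G` on the data register, or one use of `G`, controlled on the control register being
in one of the basis states of a set `S`. -/
inductive Gate (M : ℕ) : Type
  | register (W : Matrix.unitaryGroup (Fin M) ℂ)
  | query (S : Finset (Fin M))

/-- A circuit is a list of gates, the head of which is applied first. -/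
abbrev Circuit (M : ℕ) : Type := List (Gate M)

section Semantics

variable {M : ℕ} {H : Type*} [NormedAddCommGroup H] [InnerProductSpace ℂ H]

/-- The action of a gate on the joint space. -/
def Gate.apply (G : H →L[ℂ] H) : Gate M → (Fin M → H) → (Fin M → H)
  | .register W, Φ => fun y => ∑ j, (W : Matrix (Fin M) (Fin M) ℂ) y j • Φ j
  | .query S, Φ => fun j => if j ∈ S then G (Φ j) else Φ j

/-- The number of uses of the unknown operator that a gate makes. -/
def Gate.cost : Gate M → ℕ
  | .register _ => 0
  | .query _ => 1

/-- The number of uses of the unknown operator that a circuit makes. -/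
def Circuit.cost (c : Circuit M) : ℕ := (c.map Gate.cost).sum

/-- The action of a circuit on the joint space. -/
def Circuit.run (G : H →L[ℂ] H) (c : Circuit M) (Φ : Fin M → H) : Fin M → H :=
  c.foldl (fun Φ' g => g.apply G Φ') Φ

/-- The state `|0⟩ ⊗ φ`. -/
def initState (M : ℕ) (φ : H) : Fin M → H := fun j => if (j : ℕ) = 0 then φ else 0

/-- Prepare the control register in `|0⟩`, run the circuit `c`, measure the control register and
find `y`: the resulting unnormalised state of the data register. By the Born rule its squared norm
is the probability of finding `y` (for unit `φ`), and normalised it is the state of the data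
register after the measurement. -/
def measured (G : H →L[ℂ] H) (c : Circuit M) (φ : H) (y : Fin M) : H :=
  c.run G (initState M φ) y

/-- The probability that `J` successive runs of `c` have the outcomes `y 0, …, y (J-1)`. The data
register is prepared only once, in the state `ψ`, and every run goes on with the state in which the
preceding measurement left it; the control register is reset to `|0⟩` for every run. -/
def outcomeProb (G : H →L[ℂ] H) (c : Circuit M) (ψ : H) {J : ℕ} (y : Fin J → Fin M) : ℝ :=
  ‖(List.ofFn y).foldl (measured G c) ψ‖ ^ 2

open Classical in
/-- The probability that the outcomes of `J` successive runs of `c` have the property `E`. -/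
def eventProb (G : H →L[ℂ] H) (c : Circuit M) (ψ : H) {J : ℕ} (E : (Fin J → Fin M) → Prop) : ℝ :=
  ∑ y with E y, outcomeProb G c ψ y

end Semantics

/-! ### Amplitude estimation -/

/-- The matrix of the quantum Fourier transform `|j⟩ ↦ M^(-1/2) ∑ y, exp(2πi j y / M) |y⟩`. -/
def fourierMatrix (M : ℕ) : Matrix (Fin M) (Fin M) ℂ :=
  Matrix.of fun y j =>
    Complex.exp (2 * Real.pi * Complex.I / M) ^ ((y : ℕ) * (j : ℕ)) / (Real.sqrt M : ℂ)

theorem fourierMatrix_mem (M : ℕ) : fourierMatrix M ∈ Matrix.unitaryGroup (Fin M) ℂ := by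
  rw [Matrix.mem_unitaryGroup_iff']
  ext i k
  have hM : M ≠ 0 := by have := i.2; omega
  have hM' : (M : ℂ) ≠ 0 := by exact_mod_cast hM
  set w : ℂ := Complex.exp (2 * Real.pi * Complex.I / M) with hw
  have hprim : IsPrimitiveRoot w M := Complex.isPrimitiveRoot_exp M hM
  have hw0 : w ≠ 0 := Complex.exp_ne_zero _
  have hconj : star w = w⁻¹ := by
    rw [hw, ← Complex.exp_neg, Complex.star_def, ← Complex.exp_conj]
    congr 1
    have h2 : (starRingEnd ℂ) 2 = 2 := Complex.conj_ofNat 2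
    simp [neg_div, h2]
  have hs : ((Real.sqrt M : ℝ) : ℂ) * (Real.sqrt M : ℝ) = M := by
    rw [← Complex.ofReal_mul, Real.mul_self_sqrt (Nat.cast_nonneg M)]
    simp
  have hs0 : ((Real.sqrt M : ℝ) : ℂ) ≠ 0 := by
    intro h
    rw [h] at hs
    simp at hs
    exact hM' hs.symm
  have key : ∀ y : Fin M, star (fourierMatrix M) i y * fourierMatrix M y k
      = (w ^ (k : ℕ) * (w ^ (i : ℕ))⁻¹) ^ (y : ℕ) / M := by
    intro y
    rw [Matrix.star_apply]
    simp only [fourierMatrix, Matrix.of_apply, ← hw]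
    rw [star_div₀, star_pow, hconj, Complex.star_def, Complex.conj_ofReal, div_mul_div_comm, hs]
    congr 1
    rw [mul_pow, inv_pow, inv_pow, ← pow_mul, ← pow_mul, mul_comm (y : ℕ) (i : ℕ),
      mul_comm (y : ℕ) (k : ℕ), mul_comm]
  rw [Matrix.mul_apply, Finset.sum_congr rfl fun y _ => key y,
    Fin.sum_univ_eq_sum_range
      (fun y => (w ^ (k : ℕ) * (w ^ (i : ℕ))⁻¹) ^ y / (M : ℂ)) M, ← Finset.sum_div]
  by_cases hik : i = k
  · subst hik
    rw [mul_inv_cancel₀ (pow_ne_zero _ hw0)]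
    simp [hM']
  · rw [Matrix.one_apply_ne hik]
    set z : ℂ := w ^ (k : ℕ) * (w ^ (i : ℕ))⁻¹ with hz
    have hz1 : z ≠ 1 := by
      intro h
      rw [hz, mul_inv_eq_one₀ (pow_ne_zero _ hw0)] at h
      exact hik (Fin.ext (hprim.pow_inj k.2 i.2 h)).symm
    have hzM : z ^ M = 1 := by
      rw [hz, mul_pow, inv_pow, ← pow_mul, ← pow_mul, mul_comm (k : ℕ), mul_comm (i : ℕ),
        pow_mul, pow_mul, hprim.pow_eq_one]
      simp
    have := geom_sum_eq hz1 M
    rw [this, hzM]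
    simp

/-- The quantum Fourier transform on the control register. -/
def fourier (M : ℕ) : Matrix.unitaryGroup (Fin M) ℂ := ⟨fourierMatrix M, fourierMatrix_mem M⟩

/-- The amplitude estimation circuit: the Fourier transform, then the controlled powers
`|j⟩ ⊗ φ ↦ |j⟩ ⊗ G^j φ` as `M - 1` controlled uses of `G` (the one with index `k` acts if `k < j`),
then the inverse Fourier transform. -/
def ampEstCircuit (M : ℕ) : Circuit M :=
  [Gate.register (fourier M)]
    ++ (List.range (M - 1)).map (fun k => Gate.query {j : Fin M | k < (j : ℕ)})
    ++ [Gate.register (fourier M)⁻¹]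

/-- The estimate `sin²(π y / M)` of `a` that a single run with outcome `y` gives. -/
def estimate {M : ℕ} (y : Fin M) : ℝ := Real.sin (Real.pi * (y : ℕ) / M) ^ 2

/-- The median of an odd number of reals: the middle one after sorting. -/
def median {r : ℕ} (x : Fin (2 * r + 1) → ℝ) : ℝ := x (Tuple.sort x ⟨r, by omega⟩)

/-- The final estimate `ã`: the median of the estimates of `2r + 1` runs. -/
def medianEstimate {M r : ℕ} (y : Fin (2 * r + 1) → Fin M) : ℝ :=
  median fun i => estimate (y i)

end

end AmpEst

/-! Let `a = sin² θ`. When `0 < a < 1`, `UV` rotates the span of `P ψ` and `ψ - P ψ` by `2θ`, so `ψ`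
is a sum of two orthogonal eigenvectors with eigenvalues `exp(±2iθ)` (`exists_eigen_decomposition`).
A run with a given outcome acts on the data register as a polynomial in `UV`, hence multiplies each
eigenvector by a scalar, `phaseAmp`. The two components stay orthogonal through all runs, so the
outcomes are a mixture of two i.i.d. sequences (`outcomeProb_of_eigen`): reusing the state is
harmless. Both components aim at the same `a`, because `sin² (π - θ) = sin² θ`.

For one eigenvector the amplitude of `y` is a geometric sum, so its probability is at most `1 / (M
sin(θ - πy/M))²`. For `M` of order `1/(ε√α)` the outcomes far from `θ` have total weight at most
`1/16` (`sum_far_le`), and the others have relative error at most `ε` (`abs_sin_sq_sub_le`). The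
median fails only if `r + 1` of the `2r + 1` runs fail, which has probability at most `4⁻ʳ`
(`sum_prod_le_of_card_bad`). If `a` is `0` or `1`, then `ψ` itself is an eigenvector whose angle,
`0` or `π/2`, lies on the grid `πy/M` for even `M`, so the outcome is certain. -/

namespace AmpEst

/-! ### Real inequalities: tails of inverse squares, angle errors, medians -/

section TailBounds

/-- Telescoping: `1/v² ≤ 1/(v - 1/2) - 1/(v + 1/2)`. -/
theorem inv_sq_tail_le {k : ℝ} (hk : 1 ≤ k) (u : ℝ) (N : ℕ) :
    ∑ n ∈ Finset.range N, (if k ≤ u + n then 1 / (u + n) ^ 2 else 0) ≤ 1 / (k - 1 / 2) := by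
  -- The `max` clamps the telescoping function at the cutoff, so that skipped terms have a
  -- nonnegative increment and `h 0 ≥ -1/(k - 1/2)`.
  set h : ℕ → ℝ := fun n => -1 / max (u + n - 1 / 2) (k - 1 / 2) with hh
  have hpos : ∀ n : ℕ, 0 < max (u + n - 1 / 2) (k - 1 / 2) := fun n =>
    lt_max_of_lt_right (by linarith)
  have step : ∀ n ∈ Finset.range N,
      (if k ≤ u + n then 1 / (u + n) ^ 2 else 0) ≤ h (n + 1) - h n := by
    intro n _
    have hmono : max (u + n - 1 / 2) (k - 1 / 2) ≤ max (u + (n + 1 : ℕ) - 1 / 2) (k - 1 / 2) := by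
      apply max_le_max_right
      push_cast
      linarith
    split_ifs with hc
    · have e1 : max (u + n - 1 / 2) (k - 1 / 2) = u + n - 1 / 2 := max_eq_left (by linarith)
      have e2 : max (u + (n + 1 : ℕ) - 1 / 2) (k - 1 / 2) = u + n + 1 / 2 := by
        rw [max_eq_left (by push_cast; linarith)]
        push_cast
        ring
      simp only [hh]
      rw [e1, e2]
      generalize u + (n : ℝ) = v at hc
      have h1 : 0 < v - 1 / 2 := by linarith
      have h2 : 0 < v + 1 / 2 := by linarith
      have : -1 / (v + 1 / 2) - -1 / (v - 1 / 2) = 1 / ((v - 1 / 2) * (v + 1 / 2)) := by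
        rw [div_sub_div _ _ h2.ne' h1.ne']
        congr 1 <;> ring
      rw [this]
      exact one_div_le_one_div_of_le (mul_pos h1 h2) (by nlinarith)
    · have := one_div_le_one_div_of_le (hpos n) hmono
      simp only [hh, neg_div]
      linarith
  refine (Finset.sum_le_sum step).trans ?_
  rw [Finset.sum_range_sub]
  have h1 : h N ≤ 0 := by
    simp only [hh, neg_div]
    have := hpos N
    simp only [Left.neg_nonpos_iff]
    positivity
  have h2 : -(1 / (k - 1 / 2)) ≤ h 0 := by
    simp only [hh, neg_div]
    exact neg_le_neg (one_div_le_one_div_of_le (by linarith) (le_max_right _ _))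
  linarith

theorem inv_sq_two_sided_tail_le {k : ℝ} (hk : 1 ≤ k) (u : ℝ) (N : ℕ) :
    ∑ n ∈ Finset.range N, (if k ≤ |u - n| then 1 / (u - n) ^ 2 else 0) ≤ 2 / (k - 1 / 2) := by
  have h1 := inv_sq_tail_le hk (-u) N
  have h2 := inv_sq_tail_le hk (u - (N - 1 : ℕ)) N
  -- The side `u - n > 0` decreases in `n`; reversing the order of summation makes it a one-sided
  -- tail.
  rw [← Finset.sum_range_reflect] at h2
  have h3 : 2 / (k - 1 / 2) = 1 / (k - 1 / 2) + 1 / (k - 1 / 2) := by ring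
  rw [h3]
  refine le_trans ?_ (add_le_add h1 h2)
  rw [← Finset.sum_add_distrib]
  refine Finset.sum_le_sum fun n hn => ?_
  have hn' : n ≤ N - 1 := by have := Finset.mem_range.1 hn; omega
  rw [Nat.cast_sub hn']
  have e1 : -u + (n : ℝ) = -(u - n) := by ring
  have e2 : u - ((N - 1 : ℕ) : ℝ) + (((N - 1 : ℕ) : ℝ) - n) = u - n := by ring
  rw [e1, e2, neg_sq]
  generalize u - (n : ℝ) = v
  have hv : 0 ≤ 1 / v ^ 2 := by positivity
  split_ifs with a b c c <;> try linarith
  rcases le_abs.1 a with h | h <;> contradiction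

theorem inv_sin_sq_le_of_abs_le {x : ℝ} (hx : |x| ≤ Real.pi / 2) :
    1 / Real.sin x ^ 2 ≤ Real.pi ^ 2 / 4 * (1 / x ^ 2) := by
  have h := Real.mul_abs_le_abs_sin hx
  rcases eq_or_ne x 0 with rfl | h0
  · simp
  have hp := Real.pi_pos
  have hx0 : 0 < |x| := abs_pos.2 h0
  have : (2 / Real.pi * |x|) ^ 2 ≤ Real.sin x ^ 2 := by
    rw [← sq_abs (Real.sin x)]
    gcongr
  calc 1 / Real.sin x ^ 2 ≤ 1 / (2 / Real.pi * |x|) ^ 2 :=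
        one_div_le_one_div_of_le (by positivity) this
    _ = _ := by
        rw [mul_pow, sq_abs]
        field_simp
        norm_num

/-- Jordan's inequality at whichever of the zeros `0`, `π`, `-π` of the sine is nearest to `x`; the
other two terms are nonnegative. -/
theorem inv_sin_sq_le {x : ℝ} (hx : |x| ≤ Real.pi) :
    1 / Real.sin x ^ 2 ≤ Real.pi ^ 2 / 4 *
      (1 / x ^ 2 + 1 / (x - Real.pi) ^ 2 + 1 / (x + Real.pi) ^ 2) := by
  obtain ⟨h1, h2⟩ := abs_le.1 hx
  have p1 : 0 ≤ Real.pi ^ 2 / 4 * (1 / x ^ 2) := by positivity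
  have p2 : 0 ≤ Real.pi ^ 2 / 4 * (1 / (x - Real.pi) ^ 2) := by positivity
  have p3 : 0 ≤ Real.pi ^ 2 / 4 * (1 / (x + Real.pi) ^ 2) := by positivity
  rw [mul_add, mul_add]
  rcases le_total (Real.pi / 2) x with h | h
  · have := inv_sin_sq_le_of_abs_le (x := x - Real.pi) (abs_le.2 ⟨by linarith, by linarith⟩)
    rw [Real.sin_sub_pi, neg_sq] at this
    linarith
  rcases le_total x (-(Real.pi / 2)) with h' | h'
  · have := inv_sin_sq_le_of_abs_le (x := x + Real.pi) (abs_le.2 ⟨by linarith, by linarith⟩)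
    rw [Real.sin_add_pi, neg_sq] at this
    linarith
  · have := inv_sin_sq_le_of_abs_le (abs_le.2 ⟨h', h⟩)
    linarith

/-- The outcomes whose angle is far from `θ` have small total weight. -/
theorem sum_far_le {M : ℕ} {θ t : ℝ} (hM : 0 < M) (h0 : 0 ≤ θ) (hpi : θ ≤ Real.pi)
    (ht : 25 ≤ M * t / Real.pi) :
    ∑ y : Fin M, (if t ≤ |Real.sin (θ - Real.pi * (y : ℕ) / M)| then
      1 / (M * Real.sin (θ - Real.pi * (y : ℕ) / M)) ^ 2 else 0) ≤ 1 / 16 := by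
  have hp := Real.pi_pos
  have hMr : (0 : ℝ) < M := by exact_mod_cast hM
  set k : ℝ := M * t / Real.pi with hk
  set u : ℝ := M * θ / Real.pi with hu
  rw [Fin.sum_univ_eq_sum_range (fun y : ℕ => if t ≤ |Real.sin (θ - Real.pi * y / M)| then
      1 / (M * Real.sin (θ - Real.pi * y / M)) ^ 2 else 0) M]
  have key : ∀ y ∈ Finset.range M, (if t ≤ |Real.sin (θ - Real.pi * y / M)| then
      1 / (M * Real.sin (θ - Real.pi * y / M)) ^ 2 else 0) ≤
      1 / 4 * ((if k ≤ |u - y| then 1 / (u - y) ^ 2 else 0)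
        + (if k ≤ |(u - M) - y| then 1 / ((u - M) - y) ^ 2 else 0)
        + (if k ≤ |(u + M) - y| then 1 / ((u + M) - y) ^ 2 else 0)) := by
    intro y hy
    have hyM : (y : ℝ) < M := by exact_mod_cast Finset.mem_range.1 hy
    have hy0 : Real.pi * y / M ≤ Real.pi := by
      rw [div_le_iff₀ hMr]
      gcongr
    have hy1 : 0 ≤ Real.pi * y / M := by positivity
    set x := θ - Real.pi * y / M with hx
    have e1 : u - y = M * x / Real.pi := by rw [hx, hu]; field_simp
    have e2 : u - M - y = M * (x - Real.pi) / Real.pi := by rw [hx, hu]; field_simp; ring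
    have e3 : u + M - y = M * (x + Real.pi) / Real.pi := by rw [hx, hu]; field_simp; ring
    have scale : ∀ v : ℝ, t ≤ |v| → k ≤ |M * v / Real.pi| := by
      intro v hv
      rw [abs_div, abs_mul, abs_of_pos hMr, abs_of_pos hp, hk]
      gcongr
    -- `|sin x|` is at most the distance from `x` to each of `0`, `π`, `-π`, so all three cutoffs on
    -- the right are passed.
    by_cases hc : t ≤ |Real.sin x|
    · rw [if_pos hc, if_pos, if_pos, if_pos, e1, e2, e3, mul_pow]
      · have hb := inv_sin_sq_le (x := x) (abs_le.2 ⟨by linarith, by linarith⟩)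
        have : 1 / ((M : ℝ) ^ 2 * Real.sin x ^ 2) = 1 / (M : ℝ) ^ 2 * (1 / Real.sin x ^ 2) := by
          rw [one_div_mul_one_div]
        rw [this]
        refine (mul_le_mul_of_nonneg_left hb (by positivity)).trans (le_of_eq ?_)
        have scale_inv : ∀ v : ℝ,
            1 / (M * v / Real.pi) ^ 2 = Real.pi ^ 2 / (M : ℝ) ^ 2 * (1 / v ^ 2) := by
          intro v
          rw [div_pow, mul_pow, one_div_div, mul_one_div, div_div]
        rw [scale_inv, scale_inv, scale_inv]
        ring
      · rw [e3]
        refine scale _ (hc.trans ?_)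
        have := Real.abs_sin_le_abs (x := x + Real.pi)
        rwa [Real.sin_add_pi, abs_neg] at this
      · rw [e2]
        refine scale _ (hc.trans ?_)
        have := Real.abs_sin_le_abs (x := x - Real.pi)
        rwa [Real.sin_sub_pi, abs_neg] at this
      · rw [e1]
        exact scale _ (hc.trans Real.abs_sin_le_abs)
    · rw [if_neg hc]
      have : ∀ v : ℝ, 0 ≤ (if k ≤ |v| then 1 / v ^ 2 else 0) := by
        intro v
        split_ifs <;> positivity
      have a1 := this (u - y)
      have a2 := this (u - M - y)
      have a3 := this (u + M - y)
      linarith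
  refine (Finset.sum_le_sum key).trans ?_
  rw [← Finset.mul_sum, Finset.sum_add_distrib, Finset.sum_add_distrib]
  have hk1 : (1 : ℝ) ≤ k := by linarith
  have b1 := inv_sq_two_sided_tail_le hk1 u M
  have b2 := inv_sq_two_sided_tail_le hk1 (u - M) M
  have b3 := inv_sq_two_sided_tail_le hk1 (u + M) M
  -- This is where 25 is used; three such tails with the factor 1/4 give 1/16.
  have b4 : 2 / (k - 1 / 2) ≤ 1 / 12 := by
    rw [div_le_div_iff₀ (by linarith) (by norm_num)]
    linarith
  linarith

/-- The error factors as `sin(θ - φ) sin(θ + φ)`. The second factor is itself small, at most `2√a +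
t`, which is why precision of order `ε√a` in the angle yields error `εa`. -/
theorem abs_sin_sq_sub_le {θ φ t ε a : ℝ} (ha : Real.sin θ ^ 2 = a) (hε : ε ≤ 1)
    (ht : t ≤ ε * Real.sqrt a / 4) (h : |Real.sin (θ - φ)| < t) :
    |Real.sin φ ^ 2 - a| ≤ ε * a := by
  have e1 : Real.sin φ ^ 2 - a = -(Real.sin (θ - φ) * Real.sin (θ + φ)) := by
    rw [← ha, Real.sin_sub, Real.sin_add]
    linear_combination Real.sin θ ^ 2 * Real.sin_sq_add_cos_sq φ
      - Real.sin φ ^ 2 * Real.sin_sq_add_cos_sq θ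
  have e2 : Real.sin (θ + φ) = Real.sin (2 * θ) * Real.cos (θ - φ)
      - Real.cos (2 * θ) * Real.sin (θ - φ) := by
    rw [← Real.sin_sub]
    congr 1
    ring
  have hs : |Real.sin θ| = Real.sqrt a := by rw [← ha, Real.sqrt_sq_eq_abs]
  have hsq : Real.sqrt a * Real.sqrt a = a := Real.mul_self_sqrt (ha ▸ sq_nonneg _)
  have hsa := Real.sqrt_nonneg a
  have b1 : |Real.sin (θ + φ)| ≤ 2 * Real.sqrt a + t := by
    rw [e2]
    refine (abs_sub _ _).trans ?_
    rw [abs_mul, abs_mul, Real.sin_two_mul, abs_mul, abs_mul, hs, abs_two]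
    have c1 := Real.abs_cos_le_one (θ - φ)
    have c2 := Real.abs_cos_le_one (2 * θ)
    have c3 := Real.abs_cos_le_one θ
    have d1 : |Real.cos θ| * |Real.cos (θ - φ)| ≤ 1 := mul_le_one₀ c3 (abs_nonneg _) c1
    have d2 : |Real.cos (2 * θ)| * |Real.sin (θ - φ)| ≤ 1 * t :=
      mul_le_mul c2 h.le (abs_nonneg _) zero_le_one
    nlinarith
  have ht0 : 0 ≤ t := (abs_nonneg _).trans h.le
  rw [e1, abs_neg, abs_mul]
  calc |Real.sin (θ - φ)| * |Real.sin (θ + φ)| ≤ t * (2 * Real.sqrt a + t) :=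
        mul_le_mul h.le b1 (abs_nonneg _) ht0
    _ ≤ (ε * Real.sqrt a / 4) * (2 * Real.sqrt a + Real.sqrt a) := by
        refine mul_le_mul ht ?_ (by positivity) (ht0.trans ht)
        nlinarith
    _ = 3 / 4 * (ε * Real.sqrt a * Real.sqrt a) := by ring
    _ ≤ ε * a := by
        rw [mul_assoc, hsq]
        have : 0 ≤ ε * a := by
          rw [← hsq]
          nlinarith
        linarith

/-- If the median of `2r + 1` reals is further than `τ` from `a`, so are at least `r + 1` of
them. -/
theorem card_far_of_median_far {r : ℕ} {x : Fin (2 * r + 1) → ℝ} {a τ : ℝ}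
    (h : τ < |median x - a|) : r + 1 ≤ (Finset.univ.filter fun i => τ < |x i - a|).card := by
  set σ := Tuple.sort x with hσ
  have hm : Monotone (x ∘ σ) := Tuple.monotone_sort x
  have hmed : median x = (x ∘ σ) ⟨r, by omega⟩ := rfl
  rw [hmed] at h
  have reduce : ∀ S : Finset (Fin (2 * r + 1)), r + 1 ≤ S.card →
      (∀ j ∈ S, τ < |(x ∘ σ) j - a|) →
      r + 1 ≤ (Finset.univ.filter fun i => τ < |x i - a|).card := by
    intro S hS hj
    refine hS.trans (Finset.card_le_card_of_injOn σ ?_ σ.injective.injOn)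
    intro j hjS
    simpa using hj j hjS
  rcases lt_abs.1 h with h | h
  · refine reduce (Finset.Ici ⟨r, by omega⟩) ?_ fun j hj => ?_
    · rw [Fin.card_Ici]
      dsimp only
      omega
    · have := hm (Finset.mem_Ici.1 hj)
      exact lt_abs.2 (Or.inl (by linarith))
  · refine reduce (Finset.Iic ⟨r, by omega⟩) ?_ fun j hj => ?_
    · rw [Fin.card_Iic]
    · have := hm (Finset.mem_Iic.1 hj)
      exact lt_abs.2 (Or.inr (by linarith))

/-- A Chernoff bound: if a single trial is bad with probability at most `1/16`, then at least
`r + 1` of `2r + 1` independent trials are bad with probability at most `4⁻ʳ`. -/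
theorem sum_prod_le_of_card_bad {ι : Type*} [Fintype ι] (p : ι → ℝ) (hp : ∀ y, 0 ≤ p y)
    (hsum : ∑ y, p y = 1) (bad : ι → Prop) [DecidablePred bad] (hbad : ∑ y, (if bad y then p y else 0) ≤ 1 / 16)
    (r : ℕ) (E : (Fin (2 * r + 1) → ι) → Prop) [DecidablePred E]
    (hE : ∀ y, E y → r + 1 ≤ (Finset.univ.filter fun i => bad (y i)).card) :
    ∑ y with E y, ∏ i, p (y i) ≤ (1 / 4) ^ r := by
  -- Exponential moment with weight 16 per bad trial: its mean is at most `1 + 15/16 ≤ 2`, while on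
  -- `E` the product of the weights is at least `16^(r+1)`.
  set w : ι → ℝ := fun y => if bad y then 16 else 1 with hw
  have hw0 : ∀ y, 0 ≤ p y * w y := fun y => mul_nonneg (hp y) (by
    simp only [hw]
    split_ifs <;> norm_num)
  have hpw : ∑ y, p y * w y ≤ 2 := by
    have : ∀ y, p y * w y = p y + 15 * (if bad y then p y else 0) := by
      intro y
      simp only [hw]
      split_ifs <;> ring
    simp only [this]
    rw [Finset.sum_add_distrib, ← Finset.mul_sum, hsum]
    linarith
  have hprod : ∀ y : Fin (2 * r + 1) → ι, ∏ i, w (y i)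
      = 16 ^ (Finset.univ.filter fun i => bad (y i)).card := by
    intro y
    simp only [hw]
    rw [Finset.prod_ite]
    simp
  have main : (16 : ℝ) ^ (r + 1) * ∑ y with E y, ∏ i, p (y i) ≤ 2 ^ (2 * r + 1) := by
    calc (16 : ℝ) ^ (r + 1) * ∑ y with E y, ∏ i, p (y i)
        = ∑ y with E y, 16 ^ (r + 1) * ∏ i, p (y i) := Finset.mul_sum _ _ _
      _ ≤ ∑ y with E y, ∏ i, p (y i) * w (y i) := by
          refine Finset.sum_le_sum fun y hy => ?_
          rw [Finset.prod_mul_distrib, hprod, mul_comm]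
          refine mul_le_mul_of_nonneg_left ?_ (Finset.prod_nonneg fun i _ => hp _)
          exact pow_le_pow_right₀ (by norm_num) (hE y (Finset.mem_filter.1 hy).2)
      _ ≤ ∑ y : Fin (2 * r + 1) → ι, ∏ i, p (y i) * w (y i) :=
          Finset.sum_le_sum_of_subset_of_nonneg (Finset.filter_subset _ _)
            fun y _ _ => Finset.prod_nonneg fun i _ => hw0 _
      _ = (∑ y, p y * w y) ^ (2 * r + 1) := (Fintype.sum_pow (fun y => p y * w y) _).symm
      _ ≤ 2 ^ (2 * r + 1) := by
          gcongr
          exact Finset.sum_nonneg fun y _ => hw0 y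
  have h4 : (2 : ℝ) ^ (2 * r + 1) ≤ 16 ^ (r + 1) * (1 / 4) ^ r := by
    have : (16 : ℝ) ^ (r + 1) * (1 / 4) ^ r = 16 * 4 ^ r := by
      rw [pow_succ, mul_right_comm, ← mul_pow]
      norm_num
      ring
    rw [this, pow_succ, pow_mul]
    norm_num
    have : (0 : ℝ) < 4 ^ r := by positivity
    linarith
  exact le_of_mul_le_mul_left (main.trans h4) (by positivity)

end TailBounds

noncomputable section

/-! ### Successive runs on eigenvectors -/

section Runs

variable {M : ℕ} {H : Type*} [NormedAddCommGroup H] [InnerProductSpace ℂ H]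

/-- The amplitude of the outcome `y` when the data register is in an eigenstate of the unknown
operator with eigenvalue `z`. -/
def phaseAmp (M : ℕ) (z : ℂ) (y : Fin M) : ℂ :=
  ∑ j : Fin M, ((fourier M)⁻¹ : Matrix.unitaryGroup (Fin M) ℂ).1 y j *
    (z ^ (j : ℕ) / (Real.sqrt M : ℂ))

theorem run_queries (G : H →L[ℂ] H) (n : ℕ) (Φ : Fin M → H) (j : Fin M) :
    Circuit.run G ((List.range n).map fun k => Gate.query {j : Fin M | k < (j : ℕ)}) Φ j
      = (G ^ min n (j : ℕ)) (Φ j) := by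
  induction n with
  | zero => simp [Circuit.run]
  | succ n ih =>
    simp only [Circuit.run] at ih
    simp only [Circuit.run, List.range_succ, List.map_append, List.foldl_append, List.map_cons,
      List.map_nil, List.foldl_cons, List.foldl_nil]
    rw [Gate.apply]
    simp only [Finset.mem_filter, Finset.mem_univ, true_and]
    rw [ih]
    split_ifs with h
    · rw [min_eq_left h.le, min_eq_left (Nat.succ_le_of_lt h), pow_succ']
      rfl
    · rw [min_eq_right (not_lt.1 h), min_eq_right (by omega)]

theorem measured_ampEstCircuit (G : H →L[ℂ] H) (φ : H) (y : Fin M) :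
    measured G (ampEstCircuit M) φ y
      = ∑ j : Fin M, ((fourier M)⁻¹ : Matrix.unitaryGroup (Fin M) ℂ).1 y j •
          (1 / (Real.sqrt M : ℂ)) • (G ^ (j : ℕ)) φ := by
  have h0 : 0 < M := y.pos
  have hinit : Gate.apply G (.register (fourier M)) (initState M φ)
      = fun _ => (1 / (Real.sqrt M : ℂ)) • φ := by
    funext i
    simp only [Gate.apply, initState]
    rw [Finset.sum_eq_single ⟨0, h0⟩]
    · simp [fourier, fourierMatrix]
    · intro j _ hj
      rw [if_neg (fun h => hj (Fin.ext h)), smul_zero]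
    · simp
  have hq := run_queries (M := M) G (M - 1) (fun _ => (1 / (Real.sqrt M : ℂ)) • φ)
  simp only [Circuit.run] at hq
  simp only [measured, Circuit.run, ampEstCircuit, List.foldl_append, List.foldl_cons,
    List.foldl_nil, hinit]
  conv_lhs => rw [Gate.apply]
  refine Finset.sum_congr rfl fun j _ => ?_
  -- Since `j ≤ M - 1`, the `M - 1` queries suffice for the full power `G ^ j`.
  rw [hq, min_eq_right (by omega), map_smul]

theorem measured_ampEstCircuit_add (G : H →L[ℂ] H) (φ χ : H) (y : Fin M) :
    measured G (ampEstCircuit M) (φ + χ) y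
      = measured G (ampEstCircuit M) φ y + measured G (ampEstCircuit M) χ y := by
  simp only [measured_ampEstCircuit, map_add, smul_add, Finset.sum_add_distrib]

theorem foldl_measured_add (G : H →L[ℂ] H) (L : List (Fin M)) (φ χ : H) :
    L.foldl (measured G (ampEstCircuit M)) (φ + χ)
      = L.foldl (measured G (ampEstCircuit M)) φ + L.foldl (measured G (ampEstCircuit M)) χ := by
  induction L generalizing φ χ with
  | nil => rfl
  | cons y L ih => simp only [List.foldl_cons, measured_ampEstCircuit_add, ih]

theorem pow_apply_of_eigen {G : H →L[ℂ] H} {z : ℂ} {φ : H} (h : G φ = z • φ) (n : ℕ) :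
    (G ^ n) φ = z ^ n • φ := by
  induction n with
  | zero => simp
  | succ n ih =>
    rw [pow_succ', pow_succ, mul_smul, ← h, ← map_smul, ← ih]
    rfl

theorem measured_of_eigen {G : H →L[ℂ] H} {z : ℂ} {φ : H} (h : G φ = z • φ) (y : Fin M) :
    measured G (ampEstCircuit M) φ y = phaseAmp M z y • φ := by
  rw [measured_ampEstCircuit, phaseAmp, Finset.sum_smul]
  refine Finset.sum_congr rfl fun j _ => ?_
  rw [pow_apply_of_eigen h, smul_smul, smul_smul]
  congr 1
  ring

theorem foldl_measured_of_eigen {G : H →L[ℂ] H} {z : ℂ} {φ : H} (h : G φ = z • φ)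
    (L : List (Fin M)) :
    L.foldl (measured G (ampEstCircuit M)) φ = (L.map (phaseAmp M z)).prod • φ := by
  induction L generalizing φ with
  | nil => simp
  | cons y L ih =>
    have h' : G (phaseAmp M z y • φ) = z • phaseAmp M z y • φ := by
      rw [map_smul, h, smul_comm]
    rw [List.foldl_cons, measured_of_eigen h, ih h', smul_smul, List.map_cons, List.prod_cons,
      mul_comm]

/-- On a sum of two orthogonal eigenstates, the outcomes are distributed as a mixture of two
products. -/
theorem outcomeProb_of_eigen {G : H →L[ℂ] H} {z₁ z₂ : ℂ} {φ₁ φ₂ : H} (h₁ : G φ₁ = z₁ • φ₁)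
    (h₂ : G φ₂ = z₂ • φ₂) (horth : inner ℂ φ₁ φ₂ = 0) {J : ℕ} (y : Fin J → Fin M) :
    outcomeProb G (ampEstCircuit M) (φ₁ + φ₂) y
      = ‖φ₁‖ ^ 2 * ∏ i, ‖phaseAmp M z₁ (y i)‖ ^ 2
        + ‖φ₂‖ ^ 2 * ∏ i, ‖phaseAmp M z₂ (y i)‖ ^ 2 := by
  have hprod : ∀ z, ((List.ofFn y).map (phaseAmp M z)).prod = ∏ i, phaseAmp M z (y i) := by
    intro z
    rw [List.map_ofFn, List.prod_ofFn]
    rfl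
  rw [outcomeProb, foldl_measured_add, foldl_measured_of_eigen h₁, foldl_measured_of_eigen h₂,
    hprod, hprod, sq, norm_add_sq_eq_norm_sq_add_norm_sq_of_inner_eq_zero (𝕜 := ℂ)]
  · simp only [norm_smul, norm_prod, Finset.prod_pow]
    ring
  · rw [inner_smul_left, inner_smul_right, horth, mul_zero, mul_zero]

end Runs

/-! ### Outcome distribution for a single eigenvalue -/

section Phase

variable {M : ℕ}

theorem sum_norm_sq_unitary_mulVec (W : Matrix.unitaryGroup (Fin M) ℂ) (v : Fin M → ℂ) :
    ∑ y, ‖∑ j, W.1 y j * v j‖ ^ 2 = ∑ j, ‖v j‖ ^ 2 := by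
  have key : ∀ u : Fin M → ℂ, ((∑ y, ‖u y‖ ^ 2 : ℝ) : ℂ) = star u ⬝ᵥ u := by
    intro u
    rw [dotProduct, Complex.ofReal_sum]
    refine Finset.sum_congr rfl fun y _ => ?_
    rw [Pi.star_apply, Complex.star_def, Complex.conj_mul']
    push_cast
    rfl
  apply Complex.ofReal_injective
  have h : ∀ y, ∑ j, W.1 y j * v j = (W.1.mulVec v) y := fun y => rfl
  simp only [h]
  rw [key, key, Matrix.star_mulVec, Matrix.dotProduct_mulVec, Matrix.vecMul_vecMul,
    ← Matrix.star_eq_conjTranspose, Matrix.mem_unitaryGroup_iff'.1 W.2, Matrix.vecMul_one]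

/-- The inverse Fourier transform is unitary and is applied to a vector of `M` entries of modulus
`1/√M`. -/
theorem sum_norm_sq_phaseAmp (hM : 0 < M) (θ : ℝ) :
    ∑ y, ‖phaseAmp M (Complex.exp (2 * θ * Complex.I)) y‖ ^ 2 = 1 := by
  have hz : ‖Complex.exp (2 * θ * Complex.I)‖ = 1 := by
    have := Complex.norm_exp_ofReal_mul_I (2 * θ)
    push_cast at this
    exact this
  have hMr : (0 : ℝ) < M := by exact_mod_cast hM
  simp only [phaseAmp]
  rw [sum_norm_sq_unitary_mulVec]
  simp only [norm_div, norm_pow, hz, one_pow, Complex.norm_real, Real.norm_eq_abs, div_pow,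
    sq_abs, Real.sq_sqrt hMr.le, Finset.sum_const, Finset.card_univ, Fintype.card_fin,
    nsmul_eq_mul]
  field_simp

theorem phaseAmp_eq (hM : 0 < M) (θ : ℝ) (y : Fin M) :
    phaseAmp M (Complex.exp (2 * θ * Complex.I)) y
      = 1 / M * ∑ j ∈ Finset.range M,
        Complex.exp (2 * (θ - Real.pi * (y : ℕ) / M : ℝ) * Complex.I) ^ j := by
  have hMc : (M : ℂ) ≠ 0 := by exact_mod_cast hM.ne'
  have hs : ((Real.sqrt M : ℝ) : ℂ) * (Real.sqrt M : ℝ) = M := by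
    rw [← Complex.ofReal_mul, Real.mul_self_sqrt (Nat.cast_nonneg M)]
    simp
  rw [phaseAmp, ← Fin.sum_univ_eq_sum_range, Finset.mul_sum]
  refine Finset.sum_congr rfl fun j _ => ?_
  have hentry : ((fourier M)⁻¹ : Matrix.unitaryGroup (Fin M) ℂ).1 y j
      = star (fourierMatrix M j y) := rfl
  rw [hentry, fourierMatrix, Matrix.of_apply, star_div₀, Complex.star_def, Complex.conj_ofReal,
    map_pow, ← Complex.exp_conj, div_mul_div_comm, hs, div_eq_mul_one_div, mul_comm]
  congr 1
  rw [← Complex.exp_nat_mul, ← Complex.exp_nat_mul, ← Complex.exp_nat_mul, ← Complex.exp_add]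
  congr 1
  have h2 : (starRingEnd ℂ) 2 = 2 := Complex.conj_ofNat 2
  simp only [map_div₀, map_mul, h2, Complex.conj_ofReal, Complex.conj_I, Complex.conj_natCast]
  push_cast
  field_simp
  ring

theorem phaseAmp_of_angle_eq (hM : 0 < M) {θ : ℝ} {y : Fin M}
    (h : θ = Real.pi * (y : ℕ) / M) :
    phaseAmp M (Complex.exp (2 * θ * Complex.I)) y = 1 := by
  have hMc : (M : ℂ) ≠ 0 := by exact_mod_cast hM.ne'
  rw [phaseAmp_eq hM, ← h, sub_self]
  simp [hMc]

theorem norm_phaseAmp_sq_le (hM : 0 < M) (θ : ℝ) (y : Fin M)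
    (h : Real.sin (θ - Real.pi * (y : ℕ) / M) ≠ 0) :
    ‖phaseAmp M (Complex.exp (2 * θ * Complex.I)) y‖ ^ 2
      ≤ 1 / (M * Real.sin (θ - Real.pi * (y : ℕ) / M)) ^ 2 := by
  have hMr : (0 : ℝ) < M := by exact_mod_cast hM
  rw [phaseAmp_eq hM]
  set x : ℝ := θ - Real.pi * (y : ℕ) / M
  set q : ℂ := Complex.exp (2 * x * Complex.I) with hq
  have hq1 : ‖q‖ = 1 := by
    have := Complex.norm_exp_ofReal_mul_I (2 * x)
    push_cast at this
    exact this
  have hq2 : ‖q - 1‖ = 2 * |Real.sin x| := by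
    have := Complex.norm_exp_I_mul_ofReal_sub_one (2 * x)
    rw [mul_comm Complex.I] at this
    push_cast at this
    rw [hq, this, mul_div_cancel_left₀ _ (two_ne_zero' ℝ), norm_mul, Real.norm_eq_abs,
      Real.norm_eq_abs, abs_two]
  have hgeom : ‖∑ j ∈ Finset.range M, q ^ j‖ * (2 * |Real.sin x|) ≤ 2 := by
    rw [← hq2, ← norm_mul, geom_sum_mul]
    refine (norm_sub_le _ _).trans ?_
    rw [norm_pow, hq1, norm_one]
    norm_num
  have hpos : 0 < |Real.sin x| := abs_pos.2 h
  have hle : ‖(1 / M : ℂ) * ∑ j ∈ Finset.range M, q ^ j‖ ≤ 1 / (M * |Real.sin x|) := by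
    rw [norm_mul, norm_div, norm_one, Complex.norm_natCast, ← one_div_mul_one_div]
    refine mul_le_mul_of_nonneg_left ?_ (by positivity)
    rw [le_div_iff₀ hpos]
    linarith
  calc _ ≤ (1 / (M * |Real.sin x|)) ^ 2 := by gcongr
    _ = _ := by rw [div_pow, one_pow, mul_pow, sq_abs, mul_pow]

end Phase

/-! ### Spectral decomposition of `ψ` under `UV` -/

section Decomposition

variable {H : Type*} [NormedAddCommGroup H] [InnerProductSpace ℂ H]

theorem grover_apply (ψ : H) (P : H →L[ℂ] H) (x : H) :
    grover ψ P x = (2 * inner ℂ ψ (x - (2 : ℂ) • P x)) • ψ - (x - (2 : ℂ) • P x) := by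
  have h : grover ψ P x
      = (2 : ℂ) • inner ℂ ψ (x - (2 : ℂ) • P x) • ψ - (x - (2 : ℂ) • P x) := rfl
  rw [h, smul_smul]

/-- The eigenvector of `UV` for the eigenvalue `exp(2iθ)`, where `s = sin θ` and `c = cos θ`. -/
def eigenState (s c : ℝ) (ψ : H) (P : H →L[ℂ] H) : H :=
  (-Complex.I * (c + Complex.I * s) / (2 * s)) • P ψ
    + ((c + Complex.I * s) / (2 * c)) • (ψ - P ψ)

theorem eigenState_add {s c : ℝ} (hs : s ≠ 0) (hc : c ≠ 0) (ψ : H) (P : H →L[ℂ] H) :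
    eigenState s c ψ P + eigenState (-s) c ψ P = ψ := by
  have hsc : (c : ℂ) ≠ 0 := by exact_mod_cast hc
  have hss : (s : ℂ) ≠ 0 := by exact_mod_cast hs
  have e1 : (-Complex.I * (c + Complex.I * s) / (2 * s))
      + (-Complex.I * (c + Complex.I * (-s)) / (2 * (-s))) = (1 : ℂ) := by
    field_simp
    linear_combination (-2 * (s : ℂ)) * Complex.I_sq
  have e2 : ((c + Complex.I * s) / (2 * c)) + ((c + Complex.I * (-s)) / (2 * c)) = (1 : ℂ) := by
    field_simp
    ring
  simp only [eigenState, Complex.ofReal_neg]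
  rw [add_add_add_comm, ← add_smul, ← add_smul, e1, e2, one_smul, one_smul, add_sub_cancel]

variable [CompleteSpace H]

theorem inner_apply_of_isStarProjection {P : H →L[ℂ] H} (hP : IsStarProjection P) (x y : H) :
    inner ℂ x (P y) = inner ℂ (P x) y := by
  have h : ContinuousLinearMap.adjoint P = P := hP.isSelfAdjoint
  nth_rw 2 [← h]
  rw [ContinuousLinearMap.adjoint_inner_left]

theorem apply_apply_of_isStarProjection {P : H →L[ℂ] H} (hP : IsStarProjection P) (x : H) :
    P (P x) = P x :=
  congrArg (fun T : H →L[ℂ] H => T x) hP.isIdempotentElem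

theorem amplitude_eq_norm_sq {P : H →L[ℂ] H} (hP : IsStarProjection P) (ψ : H) :
    amplitude ψ P = ‖P ψ‖ ^ 2 := by
  rw [amplitude, ← apply_apply_of_isStarProjection hP, inner_apply_of_isStarProjection hP,
    apply_apply_of_isStarProjection hP]
  exact inner_self_eq_norm_sq (𝕜 := ℂ) _

theorem inner_apply_eq_amplitude {P : H →L[ℂ] H} (hP : IsStarProjection P) (ψ : H) :
    inner ℂ ψ (P ψ) = (amplitude ψ P : ℂ) := by
  rw [amplitude_eq_norm_sq hP, ← apply_apply_of_isStarProjection hP,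
    inner_apply_of_isStarProjection hP, inner_self_eq_norm_sq_to_K]
  simp [apply_apply_of_isStarProjection hP]

/-- `e1` and `e2` are the eigenvector equations for the matrix of `UV` in the basis `P ψ`, `ψ - P
ψ`. Only the squares of `s` and `c` are prescribed, so replacing `s` by `-s` yields the conjugate
eigenvalue. -/
theorem grover_eigenState {s c : ℝ} (hs : s ≠ 0) (hc : c ≠ 0) {ψ : H} {P : H →L[ℂ] H}
    (hψ : ‖ψ‖ = 1) (hP : IsStarProjection P) (hsa : s ^ 2 = amplitude ψ P)
    (hca : c ^ 2 = 1 - amplitude ψ P) :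
    grover ψ P (eigenState s c ψ P) = ((c + Complex.I * s) ^ 2 : ℂ) • eigenState s c ψ P := by
  have hsc : (c : ℂ) ≠ 0 := by exact_mod_cast hc
  have hss : (s : ℂ) ≠ 0 := by exact_mod_cast hs
  have hsum : (s : ℂ) ^ 2 + (c : ℂ) ^ 2 = 1 := by
    have : s ^ 2 + c ^ 2 = 1 := by rw [hsa, hca]; ring
    exact_mod_cast this
  have hPP := apply_apply_of_isStarProjection hP ψ
  have hin : inner ℂ ψ (P ψ) = (s : ℂ) ^ 2 := by
    rw [inner_apply_eq_amplitude hP, ← hsa]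
    push_cast
    rfl
  have hψψ : inner ℂ ψ ψ = (1 : ℂ) := by
    rw [inner_self_eq_norm_sq_to_K, hψ]
    simp
  rw [grover_apply, eigenState]
  set x : ℂ := -Complex.I * (c + Complex.I * s) / (2 * s) with hx
  set y : ℂ := (c + Complex.I * s) / (2 * c) with hy
  have hPx : P (x • P ψ + y • (ψ - P ψ)) = x • P ψ := by
    rw [map_add, map_smul, map_smul, map_sub, hPP, sub_self, smul_zero, add_zero]
  rw [hPx]
  simp only [inner_sub_right, inner_add_right, inner_smul_right, hin, hψψ]
  have hxs : 2 * s * x = -Complex.I * (c + Complex.I * s) := by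
    rw [hx]
    field_simp
  have hyc : 2 * c * y = c + Complex.I * s := by
    rw [hy]
    field_simp
  have e1 : ((c : ℂ) ^ 2 - (s : ℂ) ^ 2) * x + 2 * (c : ℂ) ^ 2 * y
      = (c + Complex.I * s) ^ 2 * x := by
    apply mul_left_cancel₀ (mul_ne_zero two_ne_zero hss)
    linear_combination ((c : ℂ) ^ 2 - (s : ℂ) ^ 2 - (c + Complex.I * s) ^ 2) * hxs
      + (2 * c * s : ℂ) * hyc
      + ((c + Complex.I * s) * (2 * c * s + Complex.I * s ^ 2) : ℂ) * Complex.I_sq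
  have e2 : -2 * (s : ℂ) ^ 2 * x + ((c : ℂ) ^ 2 - (s : ℂ) ^ 2) * y
      = (c + Complex.I * s) ^ 2 * y := by
    apply mul_left_cancel₀ (mul_ne_zero two_ne_zero hsc)
    linear_combination ((c : ℂ) ^ 2 - (s : ℂ) ^ 2 - (c + Complex.I * s) ^ 2) * hyc
      - (2 * c * s : ℂ) * hxs - ((c + Complex.I * s) * s ^ 2 : ℂ) * Complex.I_sq
  clear_value x y
  rw [smul_add, smul_smul (_ ^ 2) x, smul_smul (_ ^ 2) y, ← e1, ← e2]
  match_scalars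
  · linear_combination -y * hsum
  · linear_combination -(x + y) * hsum

/-- `P ψ` and `ψ - P ψ` are orthogonal with squared norms `s²` and `c²`; they contribute `-(c -
is)²/4` and `(c - is)²/4`, which cancel. -/
theorem inner_eigenState {s c : ℝ} (hs : s ≠ 0) (hc : c ≠ 0) {ψ : H} {P : H →L[ℂ] H}
    (hψ : ‖ψ‖ = 1) (hP : IsStarProjection P) (hsa : s ^ 2 = amplitude ψ P)
    (hca : c ^ 2 = 1 - amplitude ψ P) :
    inner ℂ (eigenState s c ψ P) (eigenState (-s) c ψ P) = 0 := by
  have hsc : (c : ℂ) ≠ 0 := by exact_mod_cast hc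
  have hss : (s : ℂ) ≠ 0 := by exact_mod_cast hs
  have hsum : (s : ℂ) ^ 2 + (c : ℂ) ^ 2 = 1 := by
    have : s ^ 2 + c ^ 2 = 1 := by rw [hsa, hca]; ring
    exact_mod_cast this
  have hPP := apply_apply_of_isStarProjection hP ψ
  have hin : inner ℂ ψ (P ψ) = (s : ℂ) ^ 2 := by
    rw [inner_apply_eq_amplitude hP, ← hsa]
    push_cast
    rfl
  have hψψ : inner ℂ ψ ψ = (s : ℂ) ^ 2 + (c : ℂ) ^ 2 := by
    rw [hsum, inner_self_eq_norm_sq_to_K, hψ]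
    simp
  have hin' : inner ℂ (P ψ) ψ = (s : ℂ) ^ 2 := by
    rw [← inner_apply_of_isStarProjection hP, hin]
  have hgg : inner ℂ (P ψ) (P ψ) = (s : ℂ) ^ 2 := by
    rw [← inner_apply_of_isStarProjection hP, hPP, hin]
  simp only [eigenState, inner_add_left, inner_add_right, inner_smul_left, inner_smul_right,
    inner_sub_left, inner_sub_right, hin, hin', hgg, hψψ, map_div₀, map_mul, map_add, map_neg,
    Complex.conj_I, Complex.conj_ofReal, Complex.conj_ofNat, Complex.ofReal_neg]
  field_simp
  linear_combination ((c : ℂ) ^ 2 * (c - Complex.I * s) ^ 2) * Complex.I_sq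

theorem norm_sub_apply_sq {ψ : H} {P : H →L[ℂ] H} (hψ : ‖ψ‖ = 1) (hP : IsStarProjection P) :
    ‖ψ - P ψ‖ ^ 2 = 1 - amplitude ψ P := by
  have hre : RCLike.re (inner ℂ ψ (P ψ)) = amplitude ψ P := rfl
  rw [norm_sub_sq (𝕜 := ℂ), hψ, hre, ← amplitude_eq_norm_sq hP]
  ring

theorem grover_eigenvector_of_amplitude_eq_zero {ψ : H} {P : H →L[ℂ] H} (hψ : ‖ψ‖ = 1)
    (hP : IsStarProjection P) (ha : amplitude ψ P = 0) : grover ψ P ψ = ψ := by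
  have hPψ : P ψ = 0 := by
    rw [← norm_eq_zero, ← sq_eq_zero_iff, ← amplitude_eq_norm_sq hP, ha]
  rw [grover_apply, hPψ, smul_zero, sub_zero, inner_self_eq_norm_sq_to_K, hψ]
  simp only [map_one, one_pow]
  module

theorem grover_eigenvector_of_amplitude_eq_one {ψ : H} {P : H →L[ℂ] H} (hψ : ‖ψ‖ = 1)
    (hP : IsStarProjection P) (ha : amplitude ψ P = 1) : grover ψ P ψ = (-1 : ℂ) • ψ := by
  have hPψ : P ψ = ψ := by
    have h := norm_sub_apply_sq hψ hP
    rw [ha, sub_self, sq_eq_zero_iff, norm_eq_zero, sub_eq_zero] at h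
    exact h.symm
  have hsub : ψ - (2 : ℂ) • ψ = -ψ := by module
  rw [grover_apply, hPψ, hsub, inner_neg_right, inner_self_eq_norm_sq_to_K, hψ]
  simp only [map_one, one_pow]
  module

/-- `ψ` is a sum of two orthogonal eigenvectors of `UV`. -/
theorem exists_eigen_decomposition {ψ : H} {P : H →L[ℂ] H} (hψ : ‖ψ‖ = 1)
    (hP : IsStarProjection P) :
    ∃ (θ : ℝ) (φ₁ φ₂ : H), 0 ≤ θ ∧ θ ≤ Real.pi ∧ Real.sin θ ^ 2 = amplitude ψ P ∧
      ψ = φ₁ + φ₂ ∧ inner ℂ φ₁ φ₂ = 0 ∧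
      grover ψ P φ₁ = Complex.exp (2 * θ * Complex.I) • φ₁ ∧
      grover ψ P φ₂ = Complex.exp (2 * (Real.pi - θ : ℝ) * Complex.I) • φ₂ := by
  have ha := amplitude_eq_norm_sq hP ψ
  have hdist := norm_sub_apply_sq hψ hP
  have h0 : 0 ≤ amplitude ψ P := ha ▸ sq_nonneg _
  have h1 : 0 ≤ 1 - amplitude ψ P := hdist ▸ sq_nonneg _
  -- The cases `a = 0` and `a = 1` are separate because `eigenState` divides by `s` and by `c`;
  -- there `ψ` is an eigenvector and the second component is zero.
  rcases h0.eq_or_lt with h0 | h0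
  · have hG := grover_eigenvector_of_amplitude_eq_zero hψ hP h0.symm
    refine ⟨0, ψ, 0, le_rfl, Real.pi_pos.le, ?_, (add_zero ψ).symm, inner_zero_right _, ?_, ?_⟩
    · simp [← h0]
    · simpa using hG
    · rw [map_zero, smul_zero]
  rcases h1.eq_or_lt with h1 | h1
  · have hG := grover_eigenvector_of_amplitude_eq_one hψ hP (by linarith)
    refine ⟨Real.pi / 2, ψ, 0, by positivity, by linarith [Real.pi_pos], ?_, (add_zero ψ).symm,
      inner_zero_right _, ?_, ?_⟩
    · rw [Real.sin_pi_div_two]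
      linarith
    · have hexp : Complex.exp (2 * (Real.pi / 2 : ℝ) * Complex.I) = -1 := by
        rw [← Complex.exp_pi_mul_I]
        congr 1
        push_cast
        ring
      rw [hG, hexp]
    · rw [map_zero, smul_zero]
  set s := Real.sqrt (amplitude ψ P) with hs
  set θ := Real.arcsin s with hθ
  have hs0 : 0 < s := Real.sqrt_pos.2 h0
  have hs1 : s ≤ 1 := Real.sqrt_le_one.2 (by linarith)
  have hsin : Real.sin θ = s := Real.sin_arcsin (by linarith) hs1
  have hsa : Real.sin θ ^ 2 = amplitude ψ P := by rw [hsin, hs, Real.sq_sqrt h0.le]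
  have hca : Real.cos θ ^ 2 = 1 - amplitude ψ P := by
    rw [← hsa, ← Real.sin_sq_add_cos_sq θ]
    ring
  have hsn : Real.sin θ ≠ 0 := by rw [hsin]; exact hs0.ne'
  have hcn : Real.cos θ ≠ 0 := by
    intro h
    rw [h] at hca
    norm_num at hca
    linarith
  have hsa' : (-Real.sin θ) ^ 2 = amplitude ψ P := by rw [neg_sq, hsa]
  have hexp : ∀ x : ℝ, Complex.exp (2 * x * Complex.I)
      = (Real.cos x + Complex.I * Real.sin x) ^ 2 := by
    intro x
    rw [mul_assoc, mul_comm (2 : ℂ), ← Nat.cast_ofNat (n := 2), mul_comm, Complex.exp_nat_mul,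
      Complex.exp_mul_I, Complex.ofReal_cos, Complex.ofReal_sin, mul_comm Complex.I]
  refine ⟨θ, eigenState (Real.sin θ) (Real.cos θ) ψ P,
    eigenState (-Real.sin θ) (Real.cos θ) ψ P, Real.arcsin_nonneg.2 hs0.le,
    (Real.arcsin_le_pi_div_two s).trans (by linarith [Real.pi_pos]), hsa,
    (eigenState_add hsn hcn ψ P).symm, inner_eigenState hsn hcn hψ hP hsa hca, ?_, ?_⟩
  · rw [grover_eigenState hsn hcn hψ hP hsa hca, hexp]
  -- The angle `π - θ` replaces `-θ`: same eigenvalue, but within `[0, π]`, as `sum_far_le`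
  -- requires.
  · rw [grover_eigenState (neg_ne_zero.2 hsn) hcn hψ hP hsa' hca, hexp, Real.cos_pi_sub,
      Real.sin_pi_sub]
    congr 1
    push_cast
    ring

end Decomposition

end

/-! ### Success probability of the median estimate -/

section Estimation

variable {M : ℕ}

theorem cost_ampEstCircuit (M : ℕ) : (ampEstCircuit M).cost = M - 1 := by
  simp [Circuit.cost, ampEstCircuit, Gate.cost, Function.comp_def]

/-- Independent runs on an eigenstate estimate `a` well. -/
theorem sum_prod_good_ge {θ a t ε : ℝ} (hM : 0 < M) (h0 : 0 ≤ θ) (hpi : θ ≤ Real.pi)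
    (ha : Real.sin θ ^ 2 = a) (hε : ε ≤ 1) (ht0 : 0 < t) (ht : t ≤ ε * Real.sqrt a / 4)
    (hMt : 25 ≤ M * t / Real.pi) (r : ℕ)
    [DecidablePred fun y : Fin (2 * r + 1) → Fin M => |medianEstimate y - a| ≤ ε * a] :
    1 - (1 / 4) ^ r ≤ ∑ y : Fin (2 * r + 1) → Fin M with |medianEstimate y - a| ≤ ε * a,
      ∏ i, ‖phaseAmp M (Complex.exp (2 * θ * Complex.I)) (y i)‖ ^ 2 := by
  set p : Fin M → ℝ := fun y => ‖phaseAmp M (Complex.exp (2 * θ * Complex.I)) y‖ ^ 2 with hp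
  have hp0 : ∀ y, 0 ≤ p y := fun y => sq_nonneg _
  have hsum : ∑ y, p y = 1 := sum_norm_sq_phaseAmp hM θ
  have hbad : ∑ y : Fin M, (if ε * a < |estimate y - a| then p y else 0) ≤ 1 / 16 := by
    refine le_trans (Finset.sum_le_sum fun y _ => ?_) (sum_far_le hM h0 hpi hMt)
    by_cases hy : t ≤ |Real.sin (θ - Real.pi * (y : ℕ) / M)|
    · rw [if_pos hy]
      have hne : Real.sin (θ - Real.pi * (y : ℕ) / M) ≠ 0 := abs_pos.1 (ht0.trans_le hy)
      split_ifs
      · exact norm_phaseAmp_sq_le hM θ y hne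
      · positivity
    · rw [if_neg hy, if_neg]
      exact not_lt.2 (abs_sin_sq_sub_le ha hε ht (not_le.1 hy))
  have htot : ∑ y : Fin (2 * r + 1) → Fin M, ∏ i, p (y i) = 1 := by
    rw [← Fintype.sum_pow, hsum, one_pow]
  have hle := sum_prod_le_of_card_bad p hp0 hsum (fun y => ε * a < |estimate y - a|) hbad r
    (fun y => ¬ |medianEstimate y - a| ≤ ε * a)
    (fun y hy => card_far_of_median_far (not_le.1 hy))
  have hsplit := Finset.sum_filter_add_sum_filter_not Finset.univ
    (fun y : Fin (2 * r + 1) → Fin M => |medianEstimate y - a| ≤ ε * a) (fun y => ∏ i, p (y i))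
  rw [htot] at hsplit
  linarith

variable {H : Type*} [NormedAddCommGroup H] [InnerProductSpace ℂ H]

theorem eventProb_of_eigen {G : H →L[ℂ] H} {z₁ z₂ : ℂ} {φ₁ φ₂ : H} (h₁ : G φ₁ = z₁ • φ₁)
    (h₂ : G φ₂ = z₂ • φ₂) (horth : inner ℂ φ₁ φ₂ = 0) {J : ℕ}
    (E : (Fin J → Fin M) → Prop) [DecidablePred E] :
    eventProb G (ampEstCircuit M) (φ₁ + φ₂) E
      = ‖φ₁‖ ^ 2 * (∑ y with E y, ∏ i, ‖phaseAmp M z₁ (y i)‖ ^ 2)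
        + ‖φ₂‖ ^ 2 * ∑ y with E y, ∏ i, ‖phaseAmp M z₂ (y i)‖ ^ 2 := by
  rw [eventProb, Finset.mul_sum, Finset.mul_sum, ← Finset.sum_add_distrib]
  refine Finset.sum_congr (by ext; simp) fun y _ => ?_
  exact outcomeProb_of_eigen h₁ h₂ horth y

/-- If the phase of the eigenvalue is a multiple of `2π / M`, every run has the same outcome. -/
theorem eventProb_eq_one_of_exact {G : H →L[ℂ] H} {θ : ℝ} {ψ : H} (hψ : ‖ψ‖ = 1)
    (hG : G ψ = Complex.exp (2 * θ * Complex.I) • ψ) {y₀ : Fin M}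
    (hθ : θ = Real.pi * (y₀ : ℕ) / M) {J : ℕ} (E : (Fin J → Fin M) → Prop)
    (hE : E fun _ => y₀) : eventProb G (ampEstCircuit M) ψ E = 1 := by
  classical
  have hM : 0 < M := y₀.pos
  -- The mixture formula is applied with a zero second component, whose eigenvalue is arbitrary.
  have hG0 : G 0 = (0 : ℂ) • (0 : H) := by simp
  have h := eventProb_of_eigen hG hG0 (inner_zero_right _) E
  rw [add_zero, hψ, norm_zero, one_pow, one_mul, zero_pow two_ne_zero, zero_mul, add_zero] at h
  rw [h]
  set p : Fin M → ℝ := fun y => ‖phaseAmp M (Complex.exp (2 * θ * Complex.I)) y‖ ^ 2 with hp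
  have hprod : ∀ y : Fin J → Fin M, 0 ≤ ∏ i, p (y i) := fun y =>
    Finset.prod_nonneg fun i _ => sq_nonneg _
  have hy₀ : p y₀ = 1 := by simp only [hp, phaseAmp_of_angle_eq hM hθ, norm_one, one_pow]
  apply le_antisymm
  · calc ∑ y with E y, ∏ i, p (y i) ≤ ∑ y : Fin J → Fin M, ∏ i, p (y i) :=
          Finset.sum_le_sum_of_subset_of_nonneg (Finset.filter_subset _ _) fun y _ _ => hprod y
      _ = 1 := by rw [← Fintype.sum_pow, sum_norm_sq_phaseAmp hM θ, one_pow]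
  · calc (1 : ℝ) = ∏ _i : Fin J, p y₀ := by rw [hy₀, Finset.prod_const_one]
      _ ≤ ∑ y with E y, ∏ i, p (y i) :=
          Finset.single_le_sum (f := fun y : Fin J → Fin M => ∏ i, p (y i))
            (fun y _ => hprod y) (Finset.mem_filter.2 ⟨Finset.mem_univ _, hE⟩)

variable [CompleteSpace H]

theorem le_eventProb_medianEstimate {ψ : H} {P : H →L[ℂ] H} (hψ : ‖ψ‖ = 1)
    (hP : IsStarProjection P) {t ε : ℝ} (hM : 0 < M) (hε : ε ≤ 1) (ht0 : 0 < t)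
    (ht : t ≤ ε * Real.sqrt (amplitude ψ P) / 4) (hMt : 25 ≤ M * t / Real.pi) (r : ℕ) :
    1 - (1 / 4) ^ r ≤ eventProb (grover ψ P) (ampEstCircuit M) ψ
      (fun y : Fin (2 * r + 1) → Fin M =>
        |medianEstimate y - amplitude ψ P| ≤ ε * amplitude ψ P) := by
  classical
  obtain ⟨θ, φ₁, φ₂, h0, hpi, hsin, hdec, horth, h₁, h₂⟩ := exists_eigen_decomposition hψ hP
  generalize grover ψ P = G at h₁ h₂ ⊢
  generalize amplitude ψ P = a at hsin ht ⊢
  have hnorm : ‖φ₁‖ ^ 2 + ‖φ₂‖ ^ 2 = 1 := by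
    have := norm_add_sq_eq_norm_sq_add_norm_sq_of_inner_eq_zero (𝕜 := ℂ) φ₁ φ₂ horth
    rw [← hdec, hψ] at this
    linarith
  rw [hdec, eventProb_of_eigen h₁ h₂ horth]
  have b₁ := sum_prod_good_ge hM h0 hpi hsin hε ht0 ht hMt r
  have b₂ := sum_prod_good_ge (θ := Real.pi - θ) hM (by linarith) (by linarith)
    (by rw [Real.sin_pi_sub, hsin]) hε ht0 ht hMt r
  have c₁ := mul_le_mul_of_nonneg_left b₁ (sq_nonneg ‖φ₁‖)
  have c₂ := mul_le_mul_of_nonneg_left b₂ (sq_nonneg ‖φ₂‖)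
  have : (1 : ℝ) - (1 / 4) ^ r
      = ‖φ₁‖ ^ 2 * (1 - (1 / 4) ^ r) + ‖φ₂‖ ^ 2 * (1 - (1 / 4) ^ r) := by
    rw [← add_mul, hnorm, one_mul]
  rw [this]
  exact add_le_add c₁ c₂

theorem eventProb_medianEstimate_eq_one {ψ : H} {P : H →L[ℂ] H} (hψ : ‖ψ‖ = 1)
    (hP : IsStarProjection P) (hM : 0 < M) (hM2 : Even M)
    (ha : amplitude ψ P = 0 ∨ amplitude ψ P = 1) (r : ℕ) :
    eventProb (grover ψ P) (ampEstCircuit M) ψ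
      (fun y : Fin (2 * r + 1) → Fin M => medianEstimate y = amplitude ψ P) = 1 := by
  have hMr : (M : ℝ) ≠ 0 := by exact_mod_cast hM.ne'
  rcases ha with ha | ha
  · have hG := grover_eigenvector_of_amplitude_eq_zero hψ hP ha
    refine eventProb_eq_one_of_exact (θ := 0) (y₀ := ⟨0, hM⟩) hψ (by simpa using hG) (by simp) _ ?_
    simp [medianEstimate, median, estimate, ha]
  · have hG := grover_eigenvector_of_amplitude_eq_one hψ hP ha
    obtain ⟨n, rfl⟩ := hM2
    have hn : (n : ℝ) ≠ 0 := by
      rintro h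
      simp [h] at hMr
    have hangle : Real.pi * n / (n + n : ℕ) = Real.pi / 2 := by
      push_cast
      field_simp
      norm_num
    -- Evenness of `M` makes `M/2` an outcome, with estimate exactly `1`.
    refine eventProb_eq_one_of_exact (θ := Real.pi / 2) (y₀ := ⟨n, by omega⟩) hψ ?_
      hangle.symm _ ?_
    · rw [hG, ← Complex.exp_pi_mul_I]
      congr 2
      push_cast
      ring
    · simp only [medianEstimate, median, estimate]
      rw [hangle, Real.sin_pi_div_two, ha, one_pow]

end Estimation

end AmpEst

/-! ### Choice of the parameters -/

theorem theorem1 :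
    ∃ C : ℝ, 0 < C ∧
      ∀ ε δ α : ℝ, 0 < ε → ε ≤ 1 → 0 < δ → δ < 1 → 0 < α → α ≤ 1 →
        ∃ M r : ℕ, 2 ≤ M ∧ Even M ∧
          (((2 * r + 1) * (AmpEst.ampEstCircuit M).cost : ℕ) : ℝ)
            ≤ C * (Real.log (2 / δ) / (ε * Real.sqrt α)) ∧
          ∀ (H : Type u) [NormedAddCommGroup H] [InnerProductSpace ℂ H] [CompleteSpace H]
            (ψ : H) (P : H →L[ℂ] H), ‖ψ‖ = 1 → IsStarProjection P →
            (α ≤ AmpEst.amplitude ψ P →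
              1 - δ ≤ AmpEst.eventProb (AmpEst.grover ψ P) (AmpEst.ampEstCircuit M) ψ
                (fun y : Fin (2 * r + 1) → Fin M =>
                  |AmpEst.medianEstimate y - AmpEst.amplitude ψ P|
                    ≤ ε * AmpEst.amplitude ψ P)) ∧
            (AmpEst.amplitude ψ P = 0 ∨ AmpEst.amplitude ψ P = 1 →
              AmpEst.eventProb (AmpEst.grover ψ P) (AmpEst.ampEstCircuit M) ψ
                (fun y : Fin (2 * r + 1) → Fin M =>
                  AmpEst.medianEstimate y = AmpEst.amplitude ψ P) = 1) := by
  -- `3216 = 8 · 402`: at most `8L` runs, each with at most `402/s` queries.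
  refine ⟨3216, by norm_num, fun ε δ α hε hε1 hδ hδ1 hα hα1 => ?_⟩
  have hα0 : 0 < Real.sqrt α := Real.sqrt_pos.2 hα
  set s : ℝ := ε * Real.sqrt α with hs
  have hs0 : 0 < s := mul_pos hε hα0
  have hs1 : s ≤ 1 := mul_le_one₀ hε1 hα0.le (Real.sqrt_le_one.2 hα1)
  set L : ℝ := Real.log (2 / δ) with hL
  have hL0 : 1 / 2 ≤ L := by
    have h2 : Real.log 2 ≤ L := by
      apply Real.log_le_log (by norm_num)
      rw [le_div_iff₀ hδ]
      linarith
    linarith [Real.log_two_gt_d9]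
  -- With `M = 2n` and `t = s/4`, `M t / π ≥ 100/π ≥ 25`, by `π ≤ 4`.
  set n : ℕ := ⌈200 / s⌉₊ with hn
  set r : ℕ := ⌈L⌉₊ with hr
  have hn1 : 200 / s ≤ n := Nat.le_ceil _
  have hn2 : (n : ℝ) < 200 / s + 1 := Nat.ceil_lt_add_one (by positivity)
  have hr1 : L ≤ r := Nat.le_ceil _
  have hr2 : (r : ℝ) < L + 1 := Nat.ceil_lt_add_one (by linarith)
  have hnpos : 0 < n := Nat.ceil_pos.2 (by positivity)
  have hfail : (1 / 4 : ℝ) ^ r ≤ δ := by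
    have hbase : (1 / 4 : ℝ) ≤ Real.exp (-1) := by
      rw [Real.exp_neg, one_div]
      exact inv_anti₀ (Real.exp_pos 1) (by linarith [Real.exp_one_lt_d9])
    calc (1 / 4 : ℝ) ^ r ≤ Real.exp (-1) ^ r := by gcongr
      _ = Real.exp (-r) := by rw [← Real.exp_nat_mul, mul_neg_one]
      _ ≤ Real.exp (-L) := Real.exp_le_exp.2 (by linarith)
      _ = δ / 2 := by rw [hL, Real.exp_neg, Real.exp_log (by positivity), inv_div]
      _ ≤ δ := by linarith
  refine ⟨2 * n, r, by omega, even_two_mul n, ?_, ?_⟩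
  · rw [AmpEst.cost_ampEstCircuit]
    have hM : ((2 * n - 1 : ℕ) : ℝ) ≤ 402 / s := by
      have h1 : ((2 * n - 1 : ℕ) : ℝ) ≤ 2 * n := by
        exact_mod_cast Nat.sub_le _ _
      have h2 : 1 ≤ 1 / s := by rwa [le_div_iff₀ hs0, one_mul]
      have h3 : 402 / s = 2 * (200 / s) + 2 * (1 / s) := by ring
      linarith
    -- `2r + 1 < 2L + 3`, and `3 ≤ 6L` because `L ≥ 1/2`.
    have hruns : (2 * r + 1 : ℝ) ≤ 8 * L := by linarith
    push_cast
    calc (2 * r + 1 : ℝ) * ((2 * n - 1 : ℕ) : ℝ) ≤ (8 * L) * (402 / s) :=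
          mul_le_mul hruns hM (Nat.cast_nonneg _) (by linarith)
      _ = 3216 * (L / s) := by ring
  · intro H _ _ _ ψ P hψ hP
    refine ⟨fun ha => ?_, fun ha =>
      AmpEst.eventProb_medianEstimate_eq_one hψ hP (by omega) (even_two_mul n) ha r⟩
    refine le_trans (by linarith) (AmpEst.le_eventProb_medianEstimate (t := s / 4) hψ hP
      (by omega) hε1 (by positivity) ?_ ?_ r)
    · have := Real.sqrt_le_sqrt ha
      rw [hs]
      gcongr
    · rw [le_div_iff₀ Real.pi_pos]
      have h1 : 200 ≤ n * s := (div_le_iff₀ hs0).1 hn1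
      push_cast
      linarith [Real.pi_le_four]
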